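/- For $\varepsilon\in(0,1]$ let $\Omega_\varepsilon\subset\mathbb{R}^3$ be the curved thin domain around the unit sphere $S^2$ given by $g_0(y)=y_3$ and $g_1(y)=y_2+2$, $y\in S^2$, that is, $$\Omega_\varepsilon=\{ry \mid y\in S^2,\ 1+\varepsilon y_3<r<1+\varepsilon(y_2+2)\},$$ with boundary $\Gamma_\varepsilon=\{(1+\varepsilon g_0(y))y\mid y\in S^2\}\cup\{(1+\varepsilon g_1(y))y\mid y\in S^2\}$ and unit outward normal $n_\varepsilon$. Let $$\mathcal{R}_\varepsilon=\{w(x)=a\times x+b \mid a,b\in\mathbb{R}^3,\ w\cdot n_\varepsilon=0\text{ on }\Gamma_\varepsilon\},\qquad D(u)=\tfrac12\bigl(\nabla u+(\nabla u)^T\bigr).$$ For $\beta\in[0,1)$, a number $c_\varepsilon>0$ is called a (standard) Korn constant for $\Omega_\varepsilon$ and $\beta$ if $$\|u\|_{H^1(\Omega_\varepsilon)}\le c_\varepsilon\|D(u)\|_{L^2(\Omega_\varepsilon)}$$ for all $u\in H^1(\Omega_\varepsilon)^3$ such that $u\cdot n_\varepsilon=0$ on $\Gamma_\varepsilon$ (in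 the sense of traces) and $|(u,w)_{L^2(\Omega_\varepsilon)}|\le\beta\|u\|_{L^2(\Omega_\varepsilon)}\|w\|_{L^2(\Omega_\varepsilon)}$ for all $w\in\mathcal{R}_\varepsilon$. Then: 1. For every $\varepsilon\in(0,1]$, $\Omega_\varepsilon$ is not axially symmetric around any line, i.e. there is no line such that $\Omega_\varepsilon$ is invariant under the rotation through every angle around it. 2. There exist constants $c_b>0$ and $\varepsilon_b\in(0,1]$ such that, for every $\beta\in[0,1)$ and every $\varepsilon\in(0,\varepsilon_b]$, every Korn constant $c_\varepsilon$ for $\Omega_\varepsilon$ and $\beta$ satisfies $c_\varepsilon\ge c_b\varepsilon^{-1}$. Consequently, for every $\beta\in[0,1)$ and every choice of Korn constants $c_\varepsilon$ for $\Omega_\varepsilon$ and $\beta$ (for all sufficiently small $\varepsilon>0$), $c_\varepsilon\to\infty$ as $\varepsilon\to0$. -/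

import Mathlib

open MeasureTheory Filter Topology
open scoped ContDiff

namespace ThinShell

noncomputable section

/-- Three-dimensional Euclidean space. -/
abbrev E3 : Type := EuclideanSpace ℝ (Fin 3)

/-- The cross product `a × b` on Euclidean space. -/
def cross (a b : E3) : E3 :=
  WithLp.toLp 2 (crossProduct (WithLp.ofLp a) (WithLp.ofLp b))

/-! ### Axial symmetry -/

/-- The rotation through the angle `t` around the line through `p` parallel to the unit
vector `e` (Rodrigues' formula). -/
def axialRotation (p e : E3) (t : ℝ) (x : E3) : E3 :=
  p + (Real.cos t • (x - p) + Real.sin t • cross e (x - p)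
    + ((1 - Real.cos t) * inner ℝ e (x - p)) • e)

/-- `Ω` is axially symmetric around the line through `p` parallel to the unit vector `e`: it is
invariant under the rotation through any angle around this line. -/
def IsAxiallySymmetricAround (Ω : Set E3) (p e : E3) : Prop :=
  ∀ t : ℝ, axialRotation p e t '' Ω = Ω

/-! ### Curved thin domains -/

/-- The curved thin domain `{y + r n(y) | y ∈ Γ, ε g₀(y) < r < ε g₁(y)}` around the surface `Γ`
with unit outward normal field `n`. -/
def thinDomain (Γ : Set E3) (n : E3 → E3) (g₀ g₁ : E3 → ℝ) (ε : ℝ) : Set E3 :=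
  {x | ∃ y ∈ Γ, ∃ r : ℝ, ε * g₀ y < r ∧ r < ε * g₁ y ∧ x = y + r • n y}

/-- The boundary component `{y + ε g(y) n(y) | y ∈ Γ}`. -/
def boundaryPart (Γ : Set E3) (n : E3 → E3) (g : E3 → ℝ) (ε : ℝ) : Set E3 :=
  {x | ∃ y ∈ Γ, x = y + (ε * g y) • n y}

/-- The unit sphere `S²`; its unit outward normal at `y` is `y` itself. -/
def S2 : Set E3 := Metric.sphere 0 1

/-- `g₀(y) = y₃` (coordinates are numbered from `0` in the code). -/
def g0 (y : E3) : ℝ := y 2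

/-- `g₁(y) = y₂ + 2`. -/
def g1 (y : E3) : ℝ := y 1 + 2

/-- The curved thin domain `Ω_ε` for `Γ = S²`, `g₀ = y₃`, `g₁ = y₂ + 2`. -/
def shell (ε : ℝ) : Set E3 := thinDomain S2 id g0 g1 ε

/-- The boundary `Γ_ε = Γ_ε⁰ ∪ Γ_ε¹` of `Ω_ε`. -/
def shellBoundary (ε : ℝ) : Set E3 :=
  boundaryPart S2 id g0 ε ∪ boundaryPart S2 id g1 ε

/-- `Ω_ε = {r y | y ∈ S², 1 + ε y₃ < r < 1 + ε (y₂ + 2)}`. -/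
theorem mem_shell_iff (ε : ℝ) (x : E3) :
    x ∈ shell ε ↔ ∃ y ∈ Metric.sphere (0 : E3) 1, ∃ r : ℝ,
      1 + ε * y 2 < r ∧ r < 1 + ε * (y 1 + 2) ∧ x = r • y := by
  constructor
  · rintro ⟨y, hy, r, h0, h1, rfl⟩
    simp only [g0, g1] at h0 h1
    exact ⟨y, hy, 1 + r, by linarith, by linarith, by simp [add_smul]⟩
  · rintro ⟨y, hy, r, h0, h1, rfl⟩
    refine ⟨y, hy, r - 1, ?_, ?_, by simp [sub_smul]⟩
    · simp only [g0]; linarith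
    · simp only [g1]; linarith

/-- `ν` is the unit outward normal to `∂Ω` at `x`: near `x` the set `Ω` is `{φ < 0}` for a `C¹`
function `φ` with `φ(x) = 0` whose gradient at `x` is a positive multiple of the unit
vector `ν`. -/
def IsUnitOutwardNormal (Ω : Set E3) (x ν : E3) : Prop :=
  ‖ν‖ = 1 ∧ ∃ φ : E3 → ℝ, ContDiffAt ℝ 1 φ x ∧ φ x = 0 ∧
    (∃ c : ℝ, 0 < c ∧ HasGradientAt φ (c • ν) x) ∧
    ∀ᶠ z in 𝓝 x, (z ∈ Ω ↔ φ z < 0)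

/-! ### Sobolev spaces -/

/-- The partial derivative `∂ᵢ f`. -/
def partialDeriv (i : Fin 3) (f : E3 → ℝ) (x : E3) : ℝ :=
  fderiv ℝ f x (EuclideanSpace.single i 1)

/-- `u ∈ H¹(Ω)³` with weak gradient matrix `G = (∂ᵢ uⱼ)ᵢⱼ`: both are square integrable on `Ω`, and
`∫_Ω uⱼ ∂ᵢφ = - ∫_Ω Gᵢⱼ φ` for all test functions `φ ∈ C_c^∞(Ω)`. -/
def HasH1Gradient (Ω : Set E3) (u : E3 → E3) (G : E3 → Fin 3 → Fin 3 → ℝ) : Prop :=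
  MemLp u 2 (volume.restrict Ω) ∧
  (∀ i j, MemLp (fun x => G x i j) 2 (volume.restrict Ω)) ∧
  ∀ φ : E3 → ℝ, ContDiff ℝ ∞ φ → HasCompactSupport φ → tsupport φ ⊆ Ω →
    ∀ i j, ∫ x in Ω, u x j * partialDeriv i φ x = - ∫ x in Ω, G x i j * φ x

/-- The norm of `L²(Ω)³`. -/
def l2Norm (Ω : Set E3) (u : E3 → E3) : ℝ :=
  Real.sqrt (∫ x in Ω, ‖u x‖ ^ 2)

/-- The inner product of `L²(Ω)³`. -/
def l2Inner (Ω : Set E3) (u w : E3 → E3) : ℝ :=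
  ∫ x in Ω, inner ℝ (u x) (w x)

/-- The norm of `L²(Ω)³ˣ³` (with the Frobenius norm of matrices). -/
def l2MatNorm (Ω : Set E3) (A : E3 → Fin 3 → Fin 3 → ℝ) : ℝ :=
  Real.sqrt (∫ x in Ω, ∑ i, ∑ j, A x i j ^ 2)

/-- The norm of `H¹(Ω)³` of a vector field `u` with weak gradient `G`. -/
def h1Norm (Ω : Set E3) (u : E3 → E3) (G : E3 → Fin 3 → Fin 3 → ℝ) : ℝ :=
  Real.sqrt (l2Norm Ω u ^ 2 + l2MatNorm Ω G ^ 2)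

/-- The strain rate tensor `D(u) = (∇u + (∇u)ᵀ) / 2` as a function of the gradient `G = ∇u`. -/
def strain (G : E3 → Fin 3 → Fin 3 → ℝ) (x : E3) (i j : Fin 3) : ℝ :=
  (G x i j + G x j i) / 2

/-- `b` is the trace on the surface `Γ ⊆ ∂Ω` of `u ∈ H¹(Ω)³` with weak gradient `G`: some sequence
of `C¹` vector fields converges to `u` in `H¹(Ω)³`, and its restrictions to `Γ` converge to `b` in
`L²(Γ)³` with respect to the surface measure (the two-dimensional Hausdorff measure; its
normalization does not matter here). -/
def IsTrace (Ω Γ : Set E3) (u : E3 → E3) (G : E3 → Fin 3 → Fin 3 → ℝ) (b : E3 → E3) : Prop :=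
  AEStronglyMeasurable b ((Measure.hausdorffMeasure 2 : Measure E3).restrict Γ) ∧
  ∃ U : ℕ → E3 → E3, (∀ k, ContDiff ℝ 1 (U k)) ∧
    Tendsto (fun k => eLpNorm (fun x => U k x - u x) 2 (volume.restrict Ω)) atTop (𝓝 0) ∧
    (∀ i j, Tendsto (fun k => eLpNorm (fun x => partialDeriv i (fun z => U k z j) x - G x i j) 2
      (volume.restrict Ω)) atTop (𝓝 0)) ∧
    Tendsto (fun k => eLpNorm (fun x => U k x - b x) 2
      ((Measure.hausdorffMeasure 2 : Measure E3).restrict Γ)) atTop (𝓝 0)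

/-- The impermeable boundary condition `u · n = 0` on `Γ ⊆ ∂Ω` in the sense of traces, where `n` is
the unit outward normal field. -/
def IsImpermeable (Ω Γ : Set E3) (u : E3 → E3) (G : E3 → Fin 3 → Fin 3 → ℝ) : Prop :=
  ∃ b : E3 → E3, IsTrace Ω Γ u G b ∧
    ∀ᵐ x ∂((Measure.hausdorffMeasure 2 : Measure E3).restrict Γ),
      ∀ ν : E3, IsUnitOutwardNormal Ω x ν → inner ℝ (b x) ν = 0

/-! ### The standard Korn inequality -/

/-- The infinitesimal rigid displacements `w(x) = a × x + b` with `w · n = 0` on `Γ`. -/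
def rigidTangent (Ω Γ : Set E3) : Set (E3 → E3) :=
  {w | ∃ a b : E3, w = (fun x => cross a x + b) ∧
    ∀ x ∈ Γ, ∀ ν : E3, IsUnitOutwardNormal Ω x ν → inner ℝ (w x) ν = 0}

/-- `c > 0` is a constant for the standard Korn inequality on `Ω` with boundary `Γ` and
parameter `β`: `‖u‖_{H¹(Ω)} ≤ c ‖D(u)‖_{L²(Ω)}` for all `u ∈ H¹(Ω)³` with `u · n = 0` on `Γ` and
`|(u, w)| ≤ β ‖u‖ ‖w‖` in `L²(Ω)³` for all rigid displacements `w` tangential on `Γ`. -/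
def IsKornConstant (Ω Γ : Set E3) (β c : ℝ) : Prop :=
  0 < c ∧ ∀ (u : E3 → E3) (G : E3 → Fin 3 → Fin 3 → ℝ),
    HasH1Gradient Ω u G → IsImpermeable Ω Γ u G →
    (∀ w ∈ rigidTangent Ω Γ, |l2Inner Ω u w| ≤ β * l2Norm Ω u * l2Norm Ω w) →
    h1Norm Ω u G ≤ c * l2MatNorm Ω (strain G)

end

end ThinShell

/-!
The rotation field `a × x` with `a = (0, 1, -1)` preserves `g₁ - g₀ = y₂ - y₃ + 2`, and it changes
both `g₀` and `g₁` with the velocity `-y₁`. Hence adding the radial field with velocity `-ε y₁` makes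
it exactly tangential on both components of the boundary of the shell
(`inner_testField_levelGrad`, `testField_tangent`). The gradient of the resulting test field is a
fixed antisymmetric matrix plus `ε` times the gradient of a smooth field independent of `ε`, so its
strain is pointwise at most a multiple of `ε` times its gradient (`exists_strain_testField_le`). It
is admissible in Korn's inequality for every `β`, as no nonzero rigid displacement is tangential on
the boundary (`eq_zero_of_rigid_tangent`), and it yields `c_ε ≥ c_b ε⁻¹`
(`IsKornConstant.one_le_mul`).

The triviality of the space of tangential rigid displacements also excludes axial symmetry: the
velocity field of a rotation group that preserves a set is tangential on its boundary
(`IsAxiallySymmetricAround.inner_normal_eq_zero`).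

In order to handle the normals, the shell is written as an intersection of a superlevel and a
sublevel set of functions `|x|² - α |x| - ε xᵢ` (`mem_shell_iff_levelFn`), and the condition
`v · n = 0` is shown to depend only on the gradient of the level function
(`forall_normal_inner_eq_zero_iff`).
-/

namespace ThinShell

/-! ### Unit outward normals -/

/-- The velocity of a curve through a zero `x` of `φ` decides on which side of `{φ = 0}` the curve
continues, hence whether it enters or leaves `Ω = {φ < 0}`. -/
theorem IsUnitOutwardNormal.eventually_curve {Ω : Set E3} {x ν v : E3}
    (h : IsUnitOutwardNormal Ω x ν) {γ : ℝ → E3} (hγ : HasDerivAt γ v 0) (hx : γ 0 = x) :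
    (inner ℝ ν v < 0 → ∀ᶠ t in 𝓝[>] (0 : ℝ), γ t ∈ Ω) ∧
    (0 < inner ℝ ν v → ∀ᶠ t in 𝓝[>] (0 : ℝ), γ t ∉ Ω) := by
  obtain ⟨-, φ, -, h0, ⟨c, hc, hg⟩, hΩ⟩ := h
  subst hx
  have hd : HasDerivAt (φ ∘ γ) (c * inner ℝ ν v) 0 := by
    have := (hasGradientAt_iff_hasFDerivAt.1 hg).comp_hasDerivAt (0 : ℝ) hγ
    simpa [inner_smul_left] using this
  have hs := hd.tendsto_slope_zero_right
  have hmem : ∀ᶠ t in 𝓝[>] (0 : ℝ), (γ t ∈ Ω ↔ φ (γ t) < 0) :=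
    (hγ.continuousAt.eventually hΩ).filter_mono nhdsWithin_le_nhds
  constructor <;> intro hv
  · filter_upwards [hs.eventually_lt_const (mul_neg_of_pos_of_neg hc hv), hmem,
      self_mem_nhdsWithin] with t ht hm htpos
    rw [hm]
    simp only [zero_add, Function.comp_apply, h0, sub_zero, smul_eq_mul] at ht
    exact (pos_iff_neg_of_mul_neg ht).1 (inv_pos.2 htpos)
  · filter_upwards [hs.eventually_const_lt (mul_pos hc hv), hmem,
      self_mem_nhdsWithin] with t ht hm htpos
    rw [hm, not_lt]
    simp only [zero_add, Function.comp_apply, h0, sub_zero, smul_eq_mul] at ht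
    exact (pos_of_mul_pos_right ht (inv_pos.2 htpos).le).le

/-- The tangent plane does not depend on the normal, as any two unit
outward normals at a point agree. -/
theorem IsUnitOutwardNormal.inner_eq_zero {Ω : Set E3} {x μ ν v : E3}
    (hμ : IsUnitOutwardNormal Ω x μ) (hν : IsUnitOutwardNormal Ω x ν)
    (hv : inner ℝ v μ = 0) : inner ℝ v ν = 0 := by
  have key : ∀ v : E3, inner ℝ v μ = 0 → 0 ≤ inner ℝ ν v := by
    intro v hv
    by_contra! hlt
    -- For small `s > 0`, the line in direction `v + s μ` enters `Ω` according to `ν`, but leaves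
    -- `Ω` according to `μ`.
    have hs : ∀ᶠ s in 𝓝[>] (0 : ℝ), inner ℝ ν (v + s • μ) < 0 := by
      have : ContinuousAt (fun s : ℝ => inner ℝ ν (v + s • μ)) 0 := by fun_prop
      exact (this.eventually (gt_mem_nhds (by simpa using hlt))).filter_mono nhdsWithin_le_nhds
    obtain ⟨s, hs, hs0⟩ := (hs.and self_mem_nhdsWithin).exists
    have hγ : HasDerivAt (fun t : ℝ => x + t • (v + s • μ)) (v + s • μ) 0 := by
      simpa using ((hasDerivAt_id (0 : ℝ)).smul_const (v + s • μ)).const_add x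
    have hpos : 0 < inner ℝ μ (v + s • μ) := by
      rw [inner_add_right, inner_smul_right, real_inner_self_eq_norm_sq, hμ.1,
        real_inner_comm, hv]
      simpa using hs0
    obtain ⟨t, h1, h2⟩ := (((hν.eventually_curve hγ (by simp)).1 hs).and
      ((hμ.eventually_curve hγ (by simp)).2 hpos)).exists
    exact h2 h1
  have h1 := key v hv
  have h2 := key (-v) (by simp [hv])
  rw [inner_neg_right] at h2
  rw [real_inner_comm]
  linarith

/-- Where `Ω` is a sublevel set of a `C¹` function, the condition `v · n = 0` refers to its
gradient. -/
theorem forall_normal_inner_eq_zero_iff {Ω : Set E3} {x g v : E3} {φ : E3 → ℝ}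
    (hφ : ContDiffAt ℝ 1 φ x) (h0 : φ x = 0) (hg : HasGradientAt φ g x) (hg0 : g ≠ 0)
    (hΩ : ∀ᶠ z in 𝓝 x, (z ∈ Ω ↔ φ z < 0)) :
    (∀ ν, IsUnitOutwardNormal Ω x ν → inner ℝ v ν = 0) ↔ inner ℝ v g = 0 := by
  have hn : ‖g‖ ≠ 0 := norm_ne_zero_iff.2 hg0
  have hu : IsUnitOutwardNormal Ω x (‖g‖⁻¹ • g) := by
    refine ⟨by simp [norm_smul, hn], φ, hφ, h0, ⟨‖g‖, norm_pos_iff.2 hg0, ?_⟩, hΩ⟩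
    rwa [smul_smul, mul_inv_cancel₀ hn, one_smul]
  have e : inner ℝ v (‖g‖⁻¹ • g) = 0 ↔ inner ℝ v g = 0 := by simp [inner_smul_right, hn]
  exact ⟨fun h => e.1 (h _ hu), fun h ν hν => hu.inner_eq_zero hν (e.2 h)⟩

/-! ### Level functions of the shell -/

/-- The function `|x|² - α |x| - ε xᵢ`, which for `x = r y` with `|y| = 1` equals
`r (r - α - ε yᵢ)`. It vanishes on the inner boundary of the shell for `α = 1`, `i = 2` and on the
outer one for `α = 1 + 2 ε`, `i = 1`. -/
noncomputable def levelFn (α ε : ℝ) (i : Fin 3) (x : E3) : ℝ := ‖x‖ ^ 2 - α * ‖x‖ - ε * x i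

/-- The gradient of `levelFn α ε i` at `x ≠ 0`. -/
noncomputable def levelGrad (α ε : ℝ) (i : Fin 3) (x : E3) : E3 :=
  (2 - α / ‖x‖) • x - ε • EuclideanSpace.single i 1

theorem inner_levelGrad (α ε : ℝ) (i : Fin 3) (v x : E3) :
    inner ℝ v (levelGrad α ε i x) = (2 - α / ‖x‖) * inner ℝ v x - ε * v i := by
  simp [levelGrad, inner_sub_right, inner_smul_right, EuclideanSpace.inner_single_right]

theorem continuous_levelFn (α ε : ℝ) (i : Fin 3) : Continuous (levelFn α ε i) := by
  unfold levelFn; fun_prop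

theorem contDiffAt_levelFn (α ε : ℝ) (i : Fin 3) {x : E3} (hx : x ≠ 0) :
    ContDiffAt ℝ 1 (levelFn α ε i) x := by
  unfold levelFn
  have h := contDiffAt_norm (n := 1) ℝ hx
  have h2 : ContDiffAt ℝ 1 (fun x : E3 => x i) x := by fun_prop
  exact ((h.pow 2).sub (contDiffAt_const.mul h)).sub (contDiffAt_const.mul h2)

theorem hasGradientAt_levelFn (α ε : ℝ) (i : Fin 3) {x : E3} (hx : x ≠ 0) :
    HasGradientAt (levelFn α ε i) (levelGrad α ε i x) x := by
  have hn : ‖x‖ ≠ 0 := norm_ne_zero_iff.2 hx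
  have hsq := (hasStrictFDerivAt_norm_sq (F := E3) x).hasFDerivAt
  have hnorm := hsq.sqrt (by positivity)
  simp only [Real.sqrt_sq (norm_nonneg _)] at hnorm
  have hp := (EuclideanSpace.proj i : E3 →L[ℝ] ℝ).hasFDerivAt (x := x)
  rw [hasGradientAt_iff_hasFDerivAt]
  refine ((hsq.sub (hnorm.const_mul α)).sub (hp.const_mul ε)).congr_fderiv ?_
  ext v
  rw [InnerProductSpace.toDual_apply_apply, real_inner_comm, inner_levelGrad]
  simp [real_inner_comm v x]
  field_simp

theorem levelGrad_ne_zero {α ε : ℝ} {i : Fin 3} {x : E3} (hx : x ≠ 0) (h0 : levelFn α ε i x = 0) :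
    levelGrad α ε i x ≠ 0 := by
  intro h
  have h1 := inner_levelGrad α ε i x x
  have hn : ‖x‖ ≠ 0 := norm_ne_zero_iff.2 hx
  rw [h, inner_zero_right, real_inner_self_eq_norm_sq] at h1
  unfold levelFn at h0
  have h2 : ‖x‖ ^ 2 = 0 := by
    field_simp at h1
    linear_combination -h0 - h1
  exact hn (by simpa using h2)

/-- A form of the description `Ω_ε = {r y | 1 + ε y₃ < r < 1 + ε (y₂ + 2)}` without quotients. It
needs `ε ≤ 1`, which ensures `r > 0`. -/
theorem mem_shell_iff_levelFn {ε : ℝ} (h0 : 0 < ε) (h1 : ε ≤ 1) (x : E3) :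
    x ∈ shell ε ↔ 0 < levelFn 1 ε 2 x ∧ levelFn (1 + 2 * ε) ε 1 x < 0 := by
  rw [mem_shell_iff]
  constructor
  · rintro ⟨y, hy, r, hr0, hr1, rfl⟩
    have hy1 : ‖y‖ = 1 := by simpa using hy
    have hy2 : |y 2| ≤ 1 := by simpa [hy1] using PiLp.norm_apply_le y 2
    have hr : 0 < r := by nlinarith [abs_le.1 hy2]
    have hn : ‖r • y‖ = r := by rw [norm_smul, hy1, mul_one, Real.norm_of_nonneg hr.le]
    simp only [levelFn, hn, PiLp.smul_apply, smul_eq_mul]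
    constructor <;> nlinarith
  · rintro ⟨ha, hb⟩
    have hx : x ≠ 0 := by
      rintro rfl
      simp [levelFn] at ha
    have hn : 0 < ‖x‖ := norm_pos_iff.2 hx
    have hn' := hn.ne'
    refine ⟨‖x‖⁻¹ • x, by simp [norm_smul, hx], ‖x‖, ?_, ?_, by simp [smul_smul, hn']⟩
    · simp only [levelFn] at ha
      simp only [PiLp.smul_apply, smul_eq_mul]
      rw [← mul_lt_mul_iff_of_pos_left hn]
      have : ‖x‖ * (1 + ε * (‖x‖⁻¹ * x.ofLp 2)) = ‖x‖ + ε * x.ofLp 2 := by field_simp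
      rw [this]; linarith
    · simp only [levelFn] at hb
      simp only [PiLp.smul_apply, smul_eq_mul]
      rw [← mul_lt_mul_iff_of_pos_left hn]
      have : ‖x‖ * (1 + ε * (‖x‖⁻¹ * x.ofLp 1 + 2)) = (1 + 2 * ε) * ‖x‖ + ε * x.ofLp 1 := by
        field_simp; ring
      rw [this]; linarith

theorem isOpen_shell {ε : ℝ} (h0 : 0 < ε) (h1 : ε ≤ 1) : IsOpen (shell ε) := by
  have : shell ε = {x | 0 < levelFn 1 ε 2 x} ∩ {x | levelFn (1 + 2 * ε) ε 1 x < 0} :=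
    Set.ext (mem_shell_iff_levelFn h0 h1)
  rw [this]
  exact (isOpen_lt continuous_const (continuous_levelFn ..)).inter
    (isOpen_lt (continuous_levelFn ..) continuous_const)

theorem shell_subset_closedBall {ε : ℝ} (h0 : 0 < ε) (h1 : ε ≤ 1) :
    shell ε ⊆ Metric.closedBall 0 4 := by
  intro x hx
  obtain ⟨y, hy, r, hr0, hr1, rfl⟩ := (mem_shell_iff ε x).1 hx
  have hy1 : ‖y‖ = 1 := by simpa using hy
  have hy2 : |y 2| ≤ 1 := by simpa [hy1] using PiLp.norm_apply_le y 2
  have hy3 : |y 1| ≤ 1 := by simpa [hy1] using PiLp.norm_apply_le y 1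
  have hr : 0 < r := by nlinarith [abs_le.1 hy2]
  rw [mem_closedBall_zero_iff, norm_smul, hy1, mul_one, Real.norm_of_nonneg hr.le]
  nlinarith [abs_le.1 hy3]

theorem shell_nonempty {ε : ℝ} (h0 : 0 < ε) : (shell ε).Nonempty := by
  refine ⟨(1 + ε) • EuclideanSpace.single 0 1, (mem_shell_iff ε _).2
    ⟨EuclideanSpace.single 0 1, by simp, 1 + ε, ?_, ?_, rfl⟩⟩
  · simpa using h0
  · simp; linarith

theorem sum_sq_eq_one {y : E3} (hy : y ∈ S2) : y 0 ^ 2 + y 1 ^ 2 + y 2 ^ 2 = 1 := by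
  have hy1 : ‖y‖ = 1 := by simpa [S2] using hy
  have := EuclideanSpace.real_norm_sq_eq y
  rw [hy1, Fin.sum_univ_three] at this
  linarith

/-- At a point of the inner boundary other than `0` (which lies on it for `ε = 1`), `v · n = 0` is
a condition on the gradient of the inner level function. -/
theorem inner_boundary_tangent_iff {ε : ℝ} (h0 : 0 < ε) (h1 : ε ≤ 1) {y : E3} (hy : y ∈ S2)
    (hr : 0 < 1 + ε * y 2) (v : E3) :
    (∀ ν, IsUnitOutwardNormal (shell ε) ((1 + ε * y 2) • y) ν → inner ℝ v ν = 0) ↔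
      inner ℝ v (levelGrad 1 ε 2 ((1 + ε * y 2) • y)) = 0 := by
  have hy1 : ‖y‖ = 1 := by simpa [S2] using hy
  set x := (1 + ε * y 2) • y with hx
  have hn : ‖x‖ = 1 + ε * y 2 := by rw [hx, norm_smul, hy1, mul_one, Real.norm_of_nonneg hr.le]
  have hx0 : x ≠ 0 := norm_pos_iff.1 (hn ▸ hr)
  have hin : levelFn 1 ε 2 x = 0 := by
    simp only [levelFn, hn]; simp [hx]; ring
  have hout : levelFn (1 + 2 * ε) ε 1 x < 0 := by
    have e : levelFn (1 + 2 * ε) ε 1 x = (1 + ε * y 2) * ε * (y 2 - y 1 - 2) := by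
      simp only [levelFn, hn]; simp [hx]; ring
    have := sum_sq_eq_one hy
    rw [e]
    exact mul_neg_of_pos_of_neg (by positivity)
      (by nlinarith [sq_nonneg (y 0), sq_nonneg (y 2 + y 1)])
  have hg := hasGradientAt_levelFn 1 ε 2 hx0
  have := forall_normal_inner_eq_zero_iff (Ω := shell ε) (v := v) (φ := fun z => -levelFn 1 ε 2 z)
    (g := -levelGrad 1 ε 2 x) (x := x) (contDiffAt_levelFn 1 ε 2 hx0).neg (by simp [hin])
    (by
      rw [hasGradientAt_iff_hasFDerivAt] at hg ⊢
      rw [map_neg]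
      exact hg.neg)
    (neg_ne_zero.2 (levelGrad_ne_zero hx0 hin))
    (by
      filter_upwards [(continuous_levelFn (1 + 2 * ε) ε 1).continuousAt.eventually
        (gt_mem_nhds hout)] with z hz
      rw [mem_shell_iff_levelFn h0 h1, neg_lt_zero]
      exact and_iff_left hz)
  simpa using this

/-- On the outer boundary, `v · n = 0` is a condition on the gradient of the outer level
function. -/
theorem outer_boundary_tangent_iff {ε : ℝ} (h0 : 0 < ε) (h1 : ε ≤ 1) {y : E3} (hy : y ∈ S2)
    (v : E3) :
    (∀ ν, IsUnitOutwardNormal (shell ε) ((1 + ε * (y 1 + 2)) • y) ν → inner ℝ v ν = 0) ↔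
      inner ℝ v (levelGrad (1 + 2 * ε) ε 1 ((1 + ε * (y 1 + 2)) • y)) = 0 := by
  have hy1 : ‖y‖ = 1 := by simpa [S2] using hy
  have hs := sum_sq_eq_one hy
  have hr : 0 < 1 + ε * (y 1 + 2) := by
    have : 0 < y 1 + 2 := by nlinarith [sq_nonneg (y 0), sq_nonneg (y 2)]
    positivity
  set x := (1 + ε * (y 1 + 2)) • y with hx
  have hn : ‖x‖ = 1 + ε * (y 1 + 2) := by
    rw [hx, norm_smul, hy1, mul_one, Real.norm_of_nonneg hr.le]
  have hx0 : x ≠ 0 := norm_pos_iff.1 (hn ▸ hr)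
  have hout : levelFn (1 + 2 * ε) ε 1 x = 0 := by
    simp only [levelFn, hn]; simp [hx]; ring
  have hin : 0 < levelFn 1 ε 2 x := by
    have e : levelFn 1 ε 2 x = (1 + ε * (y 1 + 2)) * ε * (y 1 + 2 - y 2) := by
      simp only [levelFn, hn]; simp [hx]; ring
    rw [e]
    exact mul_pos (by positivity) (by nlinarith [sq_nonneg (y 0), sq_nonneg (y 2 + y 1)])
  refine forall_normal_inner_eq_zero_iff (contDiffAt_levelFn _ ε 1 hx0) hout
    (hasGradientAt_levelFn _ ε 1 hx0) (levelGrad_ne_zero hx0 hout) ?_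
  filter_upwards [(continuous_levelFn 1 ε 2).continuousAt.eventually (lt_mem_nhds hin)] with z hz
  rw [mem_shell_iff_levelFn h0 h1]
  exact and_iff_right hz

/-! ### Rigid displacements and axial symmetry -/

theorem cross_apply_zero (a b : E3) : cross a b 0 = a 1 * b 2 - a 2 * b 1 := by
  simp [cross, cross_apply]

theorem cross_apply_one (a b : E3) : cross a b 1 = a 2 * b 0 - a 0 * b 2 := by
  simp [cross, cross_apply]

theorem cross_apply_two (a b : E3) : cross a b 2 = a 0 * b 1 - a 1 * b 0 := by
  simp [cross, cross_apply]

theorem real_inner_eq (a b : E3) : inner ℝ a b = a 0 * b 0 + a 1 * b 1 + a 2 * b 2 := by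
  simp [PiLp.inner_apply, Fin.sum_univ_three]
  ring

theorem inner_cross_self (a x : E3) : inner ℝ (cross a x) x = 0 := by
  simp only [real_inner_eq, cross_apply_zero, cross_apply_one, cross_apply_two]
  ring

/-- No nonzero rigid displacement is tangential on the boundary of the shell. On the inner boundary
the condition leaves only rotations around the `x₃`-axis, which the outer boundary excludes. -/
theorem eq_zero_of_rigid_tangent {ε : ℝ} (h0 : 0 < ε) (h1 : ε ≤ 1) {a b : E3}
    (h : ∀ x ∈ shellBoundary ε, ∀ ν, IsUnitOutwardNormal (shell ε) x ν →
      inner ℝ (cross a x + b) ν = 0) : a = 0 ∧ b = 0 := by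
  have hin : ∀ y : E3, y ∈ S2 → 0 < 1 + ε * y 2 →
      (1 + 2 * ε * y 2) * (b 0 * y 0 + b 1 * y 1 + b 2 * y 2)
        - ε * (1 + ε * y 2) * (a 0 * y 1 - a 1 * y 0) - ε * b 2 = 0 := by
    intro y hy hr
    have hy1 : ‖y‖ = 1 := by simpa [S2] using hy
    have hx : (1 + ε * y 2) • y ∈ shellBoundary ε :=
      Or.inl ⟨y, hy, by simp [g0, add_smul]⟩
    have := (inner_boundary_tangent_iff h0 h1 hy hr _).1 (h _ hx)
    rw [inner_levelGrad, norm_smul, hy1, mul_one, Real.norm_of_nonneg hr.le, inner_add_left,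
      inner_cross_self, zero_add, real_inner_eq] at this
    simp only [PiLp.add_apply, cross_apply_two, PiLp.smul_apply, smul_eq_mul] at this
    field_simp at this
    linear_combination this
  have hout : ∀ y : E3, y ∈ S2 →
      (1 + 2 * ε + 2 * ε * y 1) * (b 0 * y 0 + b 1 * y 1 + b 2 * y 2)
        - ε * (1 + ε * (y 1 + 2)) * (a 2 * y 0 - a 0 * y 2) - ε * b 1 = 0 := by
    intro y hy
    have hy1 : ‖y‖ = 1 := by simpa [S2] using hy
    have hs := sum_sq_eq_one hy
    have hr : 0 < 1 + ε * (y 1 + 2) := by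
      have : 0 < y 1 + 2 := by nlinarith [sq_nonneg (y 0), sq_nonneg (y 2)]
      positivity
    have hx : (1 + ε * (y 1 + 2)) • y ∈ shellBoundary ε :=
      Or.inr ⟨y, hy, by simp [g1, add_smul]⟩
    have := (outer_boundary_tangent_iff h0 h1 hy _).1 (h _ hx)
    rw [inner_levelGrad, norm_smul, hy1, mul_one, Real.norm_of_nonneg hr.le, inner_add_left,
      inner_cross_self, zero_add, real_inner_eq] at this
    simp only [PiLp.add_apply, cross_apply_one, PiLp.smul_apply, smul_eq_mul] at this
    field_simp at this
    linear_combination this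
  have mem : ∀ p q r : ℝ, p ^ 2 + q ^ 2 + r ^ 2 = 1 → (!₂[p, q, r] : E3) ∈ S2 := by
    intro p q r hpq
    simp [S2, EuclideanSpace.norm_eq, Fin.sum_univ_three, hpq]
  -- All points of the inner boundary used here satisfy `y₃ ≥ 0`, so they are not `0` for `ε = 1`.
  have e1 := hin !₂[1, 0, 0] (mem _ _ _ (by norm_num)) (by simp)
  have e2 := hin !₂[-1, 0, 0] (mem _ _ _ (by norm_num)) (by simp)
  have e3 := hin !₂[0, 1, 0] (mem _ _ _ (by norm_num)) (by simp)
  have e4 := hin !₂[3 / 5, 0, 4 / 5] (mem _ _ _ (by norm_num)) (by simp; positivity)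
  have e5 := hin !₂[0, 3 / 5, 4 / 5] (mem _ _ _ (by norm_num)) (by simp; positivity)
  have e6 := hout !₂[1, 0, 0] (mem _ _ _ (by norm_num))
  simp at e1 e2 e3 e4 e5 e6
  have hε := h0.ne'
  have b2 : b 2 = 0 := by
    have : ε * b 2 = 0 := by linear_combination -(e1 + e2) / 2
    simpa [hε] using this
  rw [b2] at e1 e3 e4 e5
  have b0 : b 0 = 0 := by
    have : ε * b 0 = 0 := by
      linear_combination 25 / 12 * e4 - (1 + 4 / 5 * ε) * 5 / 4 * e1
    simpa [hε] using this
  have b1 : b 1 = 0 := by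
    have : ε * b 1 = 0 := by
      linear_combination 25 / 12 * e5 - (1 + 4 / 5 * ε) * 5 / 4 * e3
    simpa [hε] using this
  have a1 : a 1 = 0 := by simpa [b0, hε] using e1
  have a0 : a 0 = 0 := by simpa [b1, hε] using e3
  have a2 : a 2 = 0 := by
    have hr : 1 + ε * 2 ≠ 0 := by positivity
    simpa [b1, b0, hε, hr] using e6
  constructor <;> ext i <;> fin_cases i <;> simp [a0, a1, a2, b0, b1, b2]

theorem axialRotation_zero (p e x : E3) : axialRotation p e 0 x = x := by
  simp [axialRotation]

/-- Rotations around an axis through opposite angles are inverse to each other. -/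
theorem axialRotation_neg_apply {p e : E3} (he : ‖e‖ = 1) (t : ℝ) (x : E3) :
    axialRotation p e (-t) (axialRotation p e t x) = x := by
  have h2 : e 0 ^ 2 + e 1 ^ 2 + e 2 ^ 2 = 1 := sum_sq_eq_one (by simpa [S2] using he)
  have hs := Real.sin_sq_add_cos_sq t
  unfold axialRotation
  simp only [Real.cos_neg, Real.sin_neg, add_sub_cancel_left]
  obtain ⟨v, rfl⟩ : ∃ v, x = p + v := ⟨x - p, by simp⟩
  simp only [add_sub_cancel_left, add_right_inj]
  generalize Real.sin t = s at *
  generalize Real.cos t = c at *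
  have hinner : inner ℝ e (c • v + s • cross e v + ((1 - c) * inner ℝ e v) • e) = inner ℝ e v := by
    rw [inner_add_right, inner_add_right, inner_smul_right, inner_smul_right, inner_smul_right,
      real_inner_self_eq_norm_sq, he]
    have : inner ℝ e (cross e v) = 0 := by
      simp only [real_inner_eq, cross_apply_zero, cross_apply_one, cross_apply_two]; ring
    rw [this]; ring
  rw [hinner, real_inner_eq]
  ext i
  fin_cases i <;>
    simp [cross_apply_zero, cross_apply_one, cross_apply_two]
  · linear_combination (v 0 - (e 0 * v 0 + e 1 * v 1 + e 2 * v 2) * e 0) * hs + s ^ 2 * v 0 * h2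
  · linear_combination (v 1 - (e 0 * v 0 + e 1 * v 1 + e 2 * v 2) * e 1) * hs + s ^ 2 * v 1 * h2
  · linear_combination (v 2 - (e 0 * v 0 + e 1 * v 1 + e 2 * v 2) * e 2) * hs + s ^ 2 * v 2 * h2

theorem hasDerivAt_axialRotation_zero (p e x : E3) :
    HasDerivAt (fun t => axialRotation p e t x) (cross e (x - p)) 0 := by
  unfold axialRotation
  have hc := Real.hasDerivAt_cos 0
  have hs := Real.hasDerivAt_sin 0
  have := (((hc.smul_const (x - p)).add (hs.smul_const (cross e (x - p)))).add
    (((hc.const_sub 1).mul_const (inner ℝ e (x - p))).smul_const e)).const_add p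
  simpa using this

/-- The velocity field of a rotation group that preserves `Ω` is tangential on `∂Ω`: otherwise the
rotations through small angles of one sign would move a boundary point into `Ω`. -/
theorem IsAxiallySymmetricAround.inner_normal_eq_zero {Ω : Set E3} {p e x ν : E3} (he : ‖e‖ = 1)
    (h : IsAxiallySymmetricAround Ω p e) (hν : IsUnitOutwardNormal Ω x ν) :
    inner ℝ (cross e (x - p)) ν = 0 := by
  have hx : x ∉ Ω := by
    obtain ⟨-, φ, -, h0, -, hΩ⟩ := hν
    rw [hΩ.self_of_nhds, h0]
    exact lt_irrefl 0
  have hmem : ∀ t, axialRotation p e t x ∉ Ω := by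
    intro t ht
    have : axialRotation p e (-t) (axialRotation p e t x) ∈ Ω := by
      rw [← h (-t)]
      exact Set.mem_image_of_mem _ ht
    rw [axialRotation_neg_apply he] at this
    exact hx this
  have hd := hasDerivAt_axialRotation_zero p e x
  rw [real_inner_comm]
  refine le_antisymm ?_ ?_ <;> by_contra! hlt
  · have hd' : HasDerivAt (fun t => axialRotation p e (-t) x) (-cross e (x - p)) 0 := by
      have := HasDerivAt.scomp (0 : ℝ) (h := fun t : ℝ => -t) (h' := -1)
        (g₁ := fun t => axialRotation p e t x) (by simpa using hd) (hasDerivAt_neg (0 : ℝ))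
      simpa [Function.comp_def] using this
    obtain ⟨t, ht⟩ := ((hν.eventually_curve hd' (by simp [axialRotation_zero])).1
      (by simpa [inner_neg_right] using hlt)).exists
    exact hmem _ ht
  · obtain ⟨t, ht⟩ := ((hν.eventually_curve hd (axialRotation_zero p e x)).1 hlt).exists
    exact hmem _ ht

theorem cross_sub (a x p : E3) : cross a (x - p) = cross a x + -cross a p := by
  ext i
  fin_cases i <;> simp [cross_apply_zero, cross_apply_one, cross_apply_two] <;> ring

theorem not_isAxiallySymmetricAround_shell {ε : ℝ} (h0 : 0 < ε) (h1 : ε ≤ 1) {p e : E3}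
    (he : ‖e‖ = 1) : ¬ IsAxiallySymmetricAround (shell ε) p e := by
  intro h
  have := (eq_zero_of_rigid_tangent h0 h1 (a := e) (b := -cross e p) fun x _ ν hν => by
    rw [← cross_sub]
    exact h.inner_normal_eq_zero he hν).1
  simp [this] at he

/-! ### Smooth vector fields on bounded domains -/

/-- The gradient matrix `(∂ᵢ uⱼ)ᵢⱼ` of a differentiable vector field. -/
noncomputable def gradMatrix (u : E3 → E3) (x : E3) (i j : Fin 3) : ℝ :=
  partialDeriv i (fun z => u z j) x

theorem contDiff_component {n : WithTop ℕ∞} {u : E3 → E3} (hu : ContDiff ℝ n u) (j : Fin 3) :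
    ContDiff ℝ n (fun z => u z j) := by fun_prop

theorem continuous_gradMatrix {u : E3 → E3} (hu : ContDiff ℝ 1 u) (i j : Fin 3) :
    Continuous (fun x => gradMatrix u x i j) :=
  ((contDiff_component hu j).continuous_fderiv one_ne_zero).clm_apply continuous_const

theorem memLp_restrict_of_continuous {F : Type*} [NormedAddCommGroup F]
    [SecondCountableTopologyEither E3 F] {f : E3 → F} (hf : Continuous f)
    {Ω : Set E3} {R : ℝ} (hΩ : Ω ⊆ Metric.closedBall 0 R) : MemLp f 2 (volume.restrict Ω) := by
  have hK := isCompact_closedBall (0 : E3) R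
  obtain ⟨C, hC⟩ := hK.exists_bound_of_continuousOn hf.continuousOn
  have : IsFiniteMeasure (volume.restrict (Metric.closedBall (0 : E3) R)) :=
    ⟨by simpa using hK.measure_lt_top (μ := volume)⟩
  exact (MemLp.of_bound hf.aestronglyMeasurable C
    (ae_restrict_of_forall_mem Metric.isClosed_closedBall.measurableSet hC)).mono_measure
    (Measure.restrict_mono hΩ le_rfl)

theorem hasH1Gradient_of_contDiff {u : E3 → E3} (hu : ContDiff ℝ 1 u) {Ω : Set E3} {R : ℝ}
    (hΩ : Ω ⊆ Metric.closedBall 0 R) : HasH1Gradient Ω u (gradMatrix u) := by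
  refine ⟨memLp_restrict_of_continuous hu.continuous hΩ,
    fun i j => memLp_restrict_of_continuous (continuous_gradMatrix hu i j) hΩ, ?_⟩
  intro φ hφ hc hs i j
  have hu' := contDiff_component hu j
  have hφ' : ContDiff ℝ 1 φ := hφ.of_le (by simp)
  have hd : Continuous (partialDeriv i φ) :=
    (hφ'.continuous_fderiv one_ne_zero).clm_apply continuous_const
  have hdc : HasCompactSupport (partialDeriv i φ) := by
    have := hc.fderiv (𝕜 := ℝ)
    exact this.comp_left (g := fun L : E3 →L[ℝ] ℝ => L (EuclideanSpace.single i 1)) (by simp)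
  have hout : ∀ x, x ∉ Ω → φ x = 0 := fun x hx =>
    image_eq_zero_of_notMem_tsupport fun h => hx (hs h)
  have hdout : ∀ x, x ∉ Ω → partialDeriv i φ x = 0 := fun x hx => by
    have : fderiv ℝ φ x = 0 :=
      image_eq_zero_of_notMem_tsupport fun h => hx (hs (tsupport_fderiv_subset ℝ h))
    simp [partialDeriv, this]
  -- Both integrands vanish outside `Ω`, so the claim is integration by parts on the whole space.
  rw [setIntegral_eq_integral_of_forall_compl_eq_zero (fun x hx => by rw [hdout x hx, mul_zero]),
    setIntegral_eq_integral_of_forall_compl_eq_zero (fun x hx => by rw [hout x hx, mul_zero])]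
  exact integral_mul_fderiv_eq_neg_fderiv_mul_of_integrable
    (((continuous_gradMatrix hu i j).mul hφ.continuous).integrable_of_hasCompactSupport hc.mul_left)
    ((hu'.continuous.mul hd).integrable_of_hasCompactSupport hdc.mul_left)
    ((hu'.continuous.mul hφ.continuous).integrable_of_hasCompactSupport hc.mul_left)
    (fun x _ => hu'.differentiable one_ne_zero x) (fun x _ => hφ'.differentiable one_ne_zero x)

/-- A `C¹` vector field is its own trace. -/
theorem isImpermeable_of_contDiff {u : E3 → E3} (hu : ContDiff ℝ 1 u) {Ω Γ : Set E3}
    (hΓ : MeasurableSet Γ)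
    (h : ∀ x ∈ Γ, ∀ ν, IsUnitOutwardNormal Ω x ν → inner ℝ (u x) ν = 0) :
    IsImpermeable Ω Γ u (gradMatrix u) := by
  refine ⟨u, ⟨hu.continuous.aestronglyMeasurable, fun _ => u, fun _ => hu, ?_, ?_, ?_⟩,
    ae_restrict_of_forall_mem hΓ h⟩
  all_goals simp [gradMatrix]

theorem measurableSet_shellBoundary (ε : ℝ) : MeasurableSet (shellBoundary ε) := by
  have hS : IsCompact S2 := isCompact_sphere 0 1
  have key : ∀ g : E3 → ℝ, Continuous g → IsCompact (boundaryPart S2 id g ε) := by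
    intro g hg
    have : boundaryPart S2 id g ε = (fun y => y + (ε * g y) • id y) '' S2 := by
      ext x; simp [boundaryPart, eq_comm]
    rw [this]
    exact hS.image (by fun_prop)
  exact ((key g0 (by unfold g0; fun_prop)).union
    (key g1 (by unfold g1; fun_prop))).isClosed.measurableSet

/-! ### The test field -/

/-- The vector `(0, 1, -1)`: rotations around this axis preserve `g₁ - g₀`. -/
noncomputable def axis : E3 := !₂[0, 1, -1]

/-- A smooth function on `ℝ³` that equals `|x|⁻²` for `|x| ≥ 1/2`. -/
noncomputable def invNormSq (x : E3) : ℝ :=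
  (‖x‖ ^ 2 + (1 - Real.smoothTransition (4 * ‖x‖ ^ 2)))⁻¹

theorem invNormSq_eq {x : E3} (hx : 1 / 2 ≤ ‖x‖) : invNormSq x = (‖x‖ ^ 2)⁻¹ := by
  rw [invNormSq, Real.smoothTransition.one_of_one_le (by nlinarith)]
  simp

theorem contDiff_invNormSq : ContDiff ℝ 1 invNormSq := by
  have hsq : ContDiff ℝ 1 (fun x : E3 => ‖x‖ ^ 2) := contDiff_norm_sq ℝ
  refine ContDiff.inv (hsq.add (contDiff_const.sub
    ((Real.smoothTransition.contDiff (n := 1)).comp (contDiff_const.mul hsq)))) fun x => ?_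
  by_cases hx : x = 0
  · simp [hx]
  · have := norm_pos_iff.2 hx
    have h1 := Real.smoothTransition.le_one (4 * ‖x‖ ^ 2)
    exact ne_of_gt (by nlinarith)

/-- The radial field `-|x|⁻² x₁ x` (for `|x| ≥ 1/2`), whose flow moves the point `r y` with
`|y| = 1` outward with velocity `-y₁`. -/
noncomputable def radialField (x : E3) : E3 := -(invNormSq x * x 0) • x

theorem contDiff_radialField : ContDiff ℝ 1 radialField := by
  have := contDiff_invNormSq
  unfold radialField
  fun_prop

/-- The rotation field around `axis`, made tangential on the boundary of the shell by a radial
field of order `ε`. -/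
noncomputable def testField (ε : ℝ) (x : E3) : E3 := cross axis x + ε • radialField x

theorem contDiff_cross (a : E3) : ContDiff ℝ 1 (cross a) := by
  rw [contDiff_euclidean]
  intro i
  fin_cases i
  · simp only [Fin.zero_eta, cross_apply_zero]; fun_prop
  · simp only [Fin.mk_one, cross_apply_one]; fun_prop
  · simp only [Fin.reduceFinMk, cross_apply_two]; fun_prop

theorem contDiff_testField (ε : ℝ) : ContDiff ℝ 1 (testField ε) :=
  (contDiff_cross axis).add (contDiff_radialField.const_smul ε)

/-- The test field is tangential on level sets of the two level functions, since the rotation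
changes `x₂` and `x₃` with the same velocity `-x₁`. -/
theorem inner_testField_levelGrad {α ε : ℝ} {i : Fin 3} {x : E3} (hi : cross axis x i = -x 0)
    (hx : 1 / 2 ≤ ‖x‖) (h0 : levelFn α ε i x = 0) :
    inner ℝ (testField ε x) (levelGrad α ε i x) = 0 := by
  have hn : ‖x‖ ≠ 0 := by linarith
  rw [inner_levelGrad, testField, inner_add_left, inner_cross_self, inner_smul_left,
    PiLp.add_apply, hi, radialField, invNormSq_eq hx, inner_smul_left, real_inner_self_eq_norm_sq]
  simp only [levelFn] at h0
  simp
  field_simp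
  linear_combination (-ε * x 0) * h0

theorem testField_tangent {ε : ℝ} (h0 : 0 < ε) (h1 : ε ≤ 1 / 2) {x : E3}
    (hx : x ∈ shellBoundary ε) (ν : E3) (hν : IsUnitOutwardNormal (shell ε) x ν) :
    inner ℝ (testField ε x) ν = 0 := by
  have hε : ε ≤ 1 := by linarith
  rcases hx with ⟨y, hy, rfl⟩ | ⟨y, hy, rfl⟩
  · have hy1 : ‖y‖ = 1 := by simpa [S2] using hy
    have hs := sum_sq_eq_one hy
    have hb : -1 ≤ y 2 := by nlinarith [sq_nonneg (y 0), sq_nonneg (y 1)]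
    have hr : 1 / 2 ≤ 1 + ε * y 2 := by nlinarith
    have e : y + (ε * g0 y) • id y = (1 + ε * y 2) • y := by simp [g0, add_smul]
    have hn : ‖(1 + ε * y 2) • y‖ = 1 + ε * y 2 := by
      rw [norm_smul, hy1, mul_one, Real.norm_of_nonneg (by linarith)]
    rw [e] at hν ⊢
    refine (inner_boundary_tangent_iff h0 hε hy (by linarith) _).2 ?_ ν hν
    refine inner_testField_levelGrad (by simp [cross_apply_two, axis]) (by rwa [hn]) ?_
    simp only [levelFn, hn]; simp; ring
  · have hy1 : ‖y‖ = 1 := by simpa [S2] using hy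
    have hs := sum_sq_eq_one hy
    have hb : -1 ≤ y 1 := by nlinarith [sq_nonneg (y 0), sq_nonneg (y 2)]
    have hr : 1 ≤ 1 + ε * (y 1 + 2) := by nlinarith
    have e : y + (ε * g1 y) • id y = (1 + ε * (y 1 + 2)) • y := by simp [g1, add_smul]
    have hn : ‖(1 + ε * (y 1 + 2)) • y‖ = 1 + ε * (y 1 + 2) := by
      rw [norm_smul, hy1, mul_one, Real.norm_of_nonneg (by linarith)]
    rw [e] at hν ⊢
    refine (outer_boundary_tangent_iff h0 hε hy _).2 ?_ ν hν
    refine inner_testField_levelGrad (by simp [cross_apply_one, axis]) (by rw [hn]; linarith) ?_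
    simp only [levelFn, hn]; simp; ring

/-! ### The strain of the test field -/

/-- The matrix of the partial derivatives of `x ↦ (0, 1, -1) × x = (x₂ + x₃, -x₁, -x₁)`. -/
noncomputable def axisMatrix : Matrix (Fin 3) (Fin 3) ℝ := !![0, -1, -1; 1, 0, 0; 1, 0, 0]

theorem gradMatrix_testField (ε : ℝ) (x : E3) (i j : Fin 3) :
    gradMatrix (testField ε) x i j = axisMatrix i j + ε * gradMatrix radialField x i j := by
  have hV : DifferentiableAt ℝ (fun z => radialField z j) x :=
    (contDiff_component contDiff_radialField j).differentiable one_ne_zero x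
  have hp : ∀ k : Fin 3, HasFDerivAt (fun z : E3 => z k) (EuclideanSpace.proj k : E3 →L[ℝ] ℝ) x :=
    fun k => (EuclideanSpace.proj k : E3 →L[ℝ] ℝ).hasFDerivAt
  have hc : HasFDerivAt (fun z => cross axis z j)
      (∑ k, axisMatrix k j • (EuclideanSpace.proj k : E3 →L[ℝ] ℝ)) x := by
    have : (fun z => cross axis z j) = fun z => ∑ k, axisMatrix k j * z k := by
      funext z
      fin_cases j <;>
        simp [cross_apply_zero, cross_apply_one, cross_apply_two, axis, axisMatrix,
          Fin.sum_univ_three, add_comm]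
    rw [this]
    exact HasFDerivAt.fun_sum fun k _ => (hp k).const_mul _
  have := (hc.add (hV.hasFDerivAt.const_mul ε)).fderiv
  have e : (fun z => testField ε z j)
      = (fun z => cross axis z j) + fun z => ε * radialField z j := by
    funext z; simp [testField]
  simp only [gradMatrix, partialDeriv, e, this]
  simp

/-- As the gradient of the rotation field is antisymmetric and does not vanish, the strain of the test
field is smaller than its gradient by a factor of order `ε`. -/
theorem exists_strain_testField_le : ∃ M : ℝ, 0 < M ∧ ∀ ε : ℝ, 0 < ε → ε * M ≤ 1 / 2 →
    ∀ x ∈ Metric.closedBall (0 : E3) 4,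
      1 / 4 ≤ ∑ i, ∑ j, gradMatrix (testField ε) x i j ^ 2 ∧
      ∑ i, ∑ j, strain (gradMatrix (testField ε)) x i j ^ 2
        ≤ (6 * M * ε) ^ 2 * ∑ i, ∑ j, gradMatrix (testField ε) x i j ^ 2 := by
  have hb : ∀ i j, ∃ C, ∀ x ∈ Metric.closedBall (0 : E3) 4, ‖gradMatrix radialField x i j‖ ≤ C :=
    fun i j => (isCompact_closedBall (0 : E3) 4).exists_bound_of_continuousOn
      (continuous_gradMatrix contDiff_radialField i j).continuousOn
  choose C hC using hb
  have hCpos : ∀ i j, 0 ≤ C i j := fun i j => (norm_nonneg _).trans (hC i j 0 (by simp))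
  have hM : ∀ i j, C i j ≤ 1 + ∑ i, ∑ j, C i j := by
    intro i j
    have h1 := Finset.single_le_sum (f := fun j => C i j) (fun j _ => hCpos i j)
      (Finset.mem_univ j)
    have h2 := Finset.single_le_sum (f := fun i => ∑ j, C i j)
      (fun i _ => Finset.sum_nonneg fun j _ => hCpos i j) (Finset.mem_univ i)
    linarith
  -- The bound of all entries of the gradient of the radial field on the ball.
  refine ⟨1 + ∑ i, ∑ j, C i j, ?_, ?_⟩
  · linarith [Finset.sum_nonneg fun i (_ : i ∈ Finset.univ) =>
      Finset.sum_nonneg fun j (_ : j ∈ Finset.univ) => hCpos i j]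
  generalize 1 + ∑ i, ∑ j, C i j = M at hM
  intro ε hε hεM x hx
  have hV : ∀ i j, |gradMatrix radialField x i j| ≤ M := fun i j => (hC i j x hx).trans (hM i j)
  have hG : 1 / 4 ≤ ∑ i, ∑ j, gradMatrix (testField ε) x i j ^ 2 := by
    have h10 : 1 / 2 ≤ gradMatrix (testField ε) x 1 0 := by
      have e : axisMatrix 1 0 = 1 := rfl
      rw [gradMatrix_testField, e]
      nlinarith [(abs_le.1 (hV 1 0)).1]
    have h1 := Finset.single_le_sum (f := fun j => gradMatrix (testField ε) x 1 j ^ 2)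
      (fun j _ => sq_nonneg _) (Finset.mem_univ 0)
    have h2 := Finset.single_le_sum (f := fun i => ∑ j, gradMatrix (testField ε) x i j ^ 2)
      (fun i _ => Finset.sum_nonneg fun j _ => sq_nonneg _) (Finset.mem_univ 1)
    nlinarith
  refine ⟨hG, ?_⟩
  have hS : ∀ i j, strain (gradMatrix (testField ε)) x i j ^ 2 ≤ (ε * M) ^ 2 := by
    intro i j
    have hanti : axisMatrix i j + axisMatrix j i = 0 := by
      fin_cases i <;> fin_cases j <;> simp [axisMatrix]
    have e : strain (gradMatrix (testField ε)) x i j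
        = ε * ((gradMatrix radialField x i j + gradMatrix radialField x j i) / 2) := by
      simp only [strain, gradMatrix_testField]
      linear_combination hanti / 2
    rw [e, sq_le_sq, abs_mul, abs_mul, abs_of_pos hε]
    refine mul_le_mul_of_nonneg_left (le_trans ?_ (le_abs_self M)) hε.le
    have h1 := abs_le.1 (hV i j)
    have h2 := abs_le.1 (hV j i)
    exact abs_le.2 ⟨by linarith, by linarith⟩
  calc ∑ i, ∑ j, strain (gradMatrix (testField ε)) x i j ^ 2
      ≤ ∑ _i : Fin 3, ∑ _j : Fin 3, (ε * M) ^ 2 :=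
        Finset.sum_le_sum fun i _ => Finset.sum_le_sum fun j _ => hS i j
    -- The nine entries contribute `9 ε² M²`, and `1 / 4` is the lower bound of the gradient.
    _ = (6 * M * ε) ^ 2 * (1 / 4) := by simp; ring
    _ ≤ _ := mul_le_mul_of_nonneg_left hG (sq_nonneg _)

/-! ### Korn constants -/

/-- Since the only rigid displacement tangential on the boundary is `0`, the orthogonality
condition is void, and the test field bounds Korn constants from below. -/
theorem IsKornConstant.one_le_mul {ε β c K : ℝ} (h0 : 0 < ε) (h1 : ε ≤ 1 / 2) (hK : 0 ≤ K)
    (h : IsKornConstant (shell ε) (shellBoundary ε) β c)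
    (hG : ∀ x ∈ shell ε, 1 / 4 ≤ ∑ i, ∑ j, gradMatrix (testField ε) x i j ^ 2)
    (hS : ∀ x ∈ shell ε, ∑ i, ∑ j, strain (gradMatrix (testField ε)) x i j ^ 2
        ≤ K ^ 2 * ∑ i, ∑ j, gradMatrix (testField ε) x i j ^ 2) : 1 ≤ c * K := by
  have hε : ε ≤ 1 := by linarith
  have hu := contDiff_testField ε
  have hsub := shell_subset_closedBall h0 hε
  have hopen := isOpen_shell h0 hε
  have hH := hasH1Gradient_of_contDiff hu hsub
  have hkorn := h.2 _ _ hH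
    (isImpermeable_of_contDiff hu (measurableSet_shellBoundary ε)
      fun x hx ν hν => testField_tangent h0 h1 hx ν hν)
    (by
      rintro w ⟨a, b, rfl, hw⟩
      obtain ⟨rfl, rfl⟩ := eq_zero_of_rigid_tangent h0 hε hw
      have hz : (fun x => cross 0 x + 0 : E3 → E3) = fun _ => 0 := by
        funext x; simp [cross]
      rw [hz]
      simp [l2Inner, l2Norm])
  set A := ∫ x in shell ε, ∑ i, ∑ j, gradMatrix (testField ε) x i j ^ 2 with hA
  have hGi : ∀ i j, IntegrableOn (fun x => gradMatrix (testField ε) x i j ^ 2) (shell ε) :=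
    fun i j => (hH.2.1 i j).integrable_sq
  have hAi : IntegrableOn (fun x => ∑ i, ∑ j, gradMatrix (testField ε) x i j ^ 2) (shell ε) :=
    integrable_finsetSum _ fun i _ => integrable_finsetSum _ fun j _ => hGi i j
  have hSi : IntegrableOn (fun x => ∑ i, ∑ j, strain (gradMatrix (testField ε)) x i j ^ 2)
      (shell ε) :=
    integrable_finsetSum _ fun i _ => integrable_finsetSum _ fun j _ =>
      (((hH.2.1 i j).add (hH.2.1 j i)).mul_const 2⁻¹).integrable_sq
  have hApos : 0 < A := by
    have hfin : volume (shell ε) < ⊤ :=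
      (measure_mono hsub).trans_lt (isCompact_closedBall _ _).measure_lt_top
    have hpos : 0 < volume (shell ε) := hopen.measure_pos _ (shell_nonempty h0)
    have hle : ∫ _ in shell ε, (1 / 4 : ℝ) ≤ A :=
      setIntegral_mono_on (integrableOn_const hfin.ne) hAi hopen.measurableSet hG
    refine lt_of_lt_of_le ?_ hle
    rw [setIntegral_const, smul_eq_mul]
    exact mul_pos (ENNReal.toReal_pos hpos.ne' hfin.ne) (by norm_num)
  have hSle : l2MatNorm (shell ε) (strain (gradMatrix (testField ε))) ≤ K * Real.sqrt A := by
    rw [l2MatNorm, ← Real.sqrt_sq hK, ← Real.sqrt_mul (sq_nonneg K), hA, ← integral_const_mul]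
    exact Real.sqrt_le_sqrt (setIntegral_mono_on hSi (hAi.const_mul _) hopen.measurableSet hS)
  have hH1 : Real.sqrt A ≤ h1Norm (shell ε) (testField ε) (gradMatrix (testField ε)) := by
    rw [h1Norm]
    refine Real.le_sqrt_of_sq_le ?_
    rw [l2MatNorm, ← hA]
    linarith [sq_nonneg (l2Norm (shell ε) (testField ε))]
  have hpos := Real.sqrt_pos.2 hApos
  have := mul_le_mul_of_nonneg_left hSle h.1.le
  by_contra! hlt
  nlinarith

end ThinShell

theorem lemma4p13 :
    (∀ ε : ℝ, 0 < ε → ε ≤ 1 →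
      ¬ ∃ p e : ThinShell.E3, ‖e‖ = 1 ∧
        ThinShell.IsAxiallySymmetricAround (ThinShell.shell ε) p e) ∧
    ∃ c_b ε_b : ℝ, 0 < c_b ∧ 0 < ε_b ∧ ε_b ≤ 1 ∧
      ∀ β : ℝ, 0 ≤ β → β < 1 →
        (∀ ε : ℝ, 0 < ε → ε ≤ ε_b → ∀ c : ℝ,
          ThinShell.IsKornConstant (ThinShell.shell ε) (ThinShell.shellBoundary ε) β c →
            c_b * ε⁻¹ ≤ c) ∧
        (∀ c : ℝ → ℝ,
          (∀ᶠ ε in 𝓝[>] (0 : ℝ),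
            ThinShell.IsKornConstant (ThinShell.shell ε) (ThinShell.shellBoundary ε) β (c ε)) →
          Tendsto c (𝓝[>] (0 : ℝ)) atTop) := by
  refine ⟨fun ε h0 h1 ⟨p, e, he, h⟩ => ThinShell.not_isAxiallySymmetricAround_shell h0 h1 he h, ?_⟩
  obtain ⟨M, hM, hstrain⟩ := ThinShell.exists_strain_testField_le
  have hb : 0 < min (1 / 2) (1 / (2 * M)) := by positivity
  refine ⟨1 / (6 * M), min (1 / 2) (1 / (2 * M)), by positivity, hb,
    (min_le_left _ _).trans (by norm_num), fun β _ _ => ?_⟩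
  have hmain : ∀ ε : ℝ, 0 < ε → ε ≤ min (1 / 2) (1 / (2 * M)) → ∀ c : ℝ,
      ThinShell.IsKornConstant (ThinShell.shell ε) (ThinShell.shellBoundary ε) β c →
        1 / (6 * M) * ε⁻¹ ≤ c := by
    intro ε h0 hε c hc
    have h1 : ε ≤ 1 / 2 := hε.trans (min_le_left _ _)
    have h2 : ε * M ≤ 1 / 2 := by
      have := (le_div_iff₀ (by positivity)).1 (hε.trans (min_le_right _ _))
      linarith
    have hsub := ThinShell.shell_subset_closedBall h0 (by linarith)
    have := hc.one_le_mul h0 h1 (K := 6 * M * ε) (by positivity)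
      (fun x hx => (hstrain ε h0 h2 x (hsub hx)).1) (fun x hx => (hstrain ε h0 h2 x (hsub hx)).2)
    rw [one_div, ← mul_inv, inv_le_iff_one_le_mul₀ (by positivity)]
    exact this
  refine ⟨hmain, fun c hc => ?_⟩
  have hlim : Tendsto (fun ε : ℝ => 1 / (6 * M) * ε⁻¹) (𝓝[>] 0) atTop :=
    tendsto_inv_nhdsGT_zero.const_mul_atTop (by positivity)
  refine tendsto_atTop_mono' _ ?_ hlim
  filter_upwards [hc, self_mem_nhdsWithin, Ioc_mem_nhdsGT hb] with ε h h0 hε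
  exact hmain ε h0 hε.2 _ h
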